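/- Notation. Let $n\ge 1$, let $\mathbb{B}_n=\{z\in\mathbb{C}^n:|z|<1\}$ be the open Euclidean unit ball, $dm$ Lebesgue measure on $\mathbb{C}^n$, and $dv=dm/\mathrm{Vol}(\mathbb{B}_n)$ the normalized measure on $\mathbb{B}_n$. For an integer $t\ge 0$ put $c_t=\frac{(n+t)!}{n!\,t!}$ and, for a square-integrable function $g$ on $\mathbb{B}_n$, $$\|g\|_t^2=\int_{\mathbb{B}_n}|g(z)|^2\,c_t\,(1-|z|^2)^t\,dv(z).$$ Let $\partial_j=\partial/\partial z_j$, let $Rp=\sum_{i=1}^n z_i\,\partial_i p$ be the radial derivative ($R^l$ is its $l$-fold iterate), let $L_{j,i}p=\overline{z_i}\,\partial_j p-\overline{z_j}\,\partial_i p$ be the complex tangential derivative, and let $\Omega_{1/2}=\{z\in\mathbb{B}_n:|z|>1/2\}$. Proposition 2.2. For all positive integers $n$ and $m$ there is a constant $C(n,m)>1$ such that, for every polynomial $p\in\mathbb{C}[z_1,\dots,z_n]$ of (total) degree $m$, every polynomial $f\in\mathbb{C}[z_1,\dots,z_n]$ and every integer $k\ge 0$: 1. $\displaystyle\|(R^l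 p)f\|_{2k}^2\le\frac{c_{2k}\,C(n,m)^{k+1}}{c_{2k-2l}}\,\|pf\|_{2k-2l}^2$ for every integer $l$ with $0\le l\le k$; 2. $\displaystyle\|(L_{j,i}p)f\|_{2k+1}^2\le\frac{c_{2k+1}\,C(n,m)^{k+1}}{c_{2k}}\,\|pf\|_{2k}^2$ for all integers $i,j$ with $1\le i\ne j\le n$; 3. $\displaystyle\|(\partial_j p)f\|_{2k+2}^2\le\frac{c_{2k+2}\,C(n,m)^{k+1}}{c_{2k}}\,\|pf\|_{2k}^2$ for every integer $j$ with $1\le j\le n$. Proposition 2.2′. For all positive integers $n$ and $m$ there is a constant $C(n,m)>1$ such that, for every polynomial $p\in\mathbb{C}[z_1,\dots,z_n]$ of degree $m$, every polynomial $f\in\mathbb{C}[z_1,\dots,z_n]$ and every integer $k\ge 0$: 1. $\displaystyle\int_{\Omega_{1/2}}|(R^lp)(z)f(z)|^2(1-|z|^2)^{2k}\,dm(z)\le C(n,m)^{k+1}\int_{\mathbb{B}_n}|p(z)f(z)|^2(1-|z|^2)^{2k-2l}\,dm(z)$ for every integer $l$ with $0\le l\le k$; 2. $\displaystyle\int_{\Omega_{1/2}}|(L_{j,i}p)(z)f(z)|^2(1-|z|^2)^{2k+1}\,dm(z)\le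 C(n,m)^{k+1}\int_{\mathbb{B}_n}|p(z)f(z)|^2(1-|z|^2)^{2k}\,dm(z)$ for all integers $i,j$ with $1\le i\ne j\le n$; 3. $\displaystyle\int_{\Omega_{1/2}}|(\partial_jp)(z)f(z)|^2(1-|z|^2)^{2k+2}\,dm(z)\le C(n,m)^{k+1}\int_{\mathbb{B}_n}|p(z)f(z)|^2(1-|z|^2)^{2k}\,dm(z)$ for every integer $j$ with $1\le j\le n$. Both propositions hold. -/

import Mathlib

open MeasureTheory
open scoped Nat ComplexConjugate

namespace PolyBergman

/-- The constant `c_t = (n+t)! / (n! t!)`. -/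
noncomputable def c (n t : ℕ) : ℝ := ((n + t)! : ℝ) / ((n ! : ℝ) * (t ! : ℝ))

/-- The open unit ball of `ℂⁿ` with its Euclidean norm. -/
def unitBall (n : ℕ) : Set (EuclideanSpace ℂ (Fin n)) := Metric.ball 0 1

/-- The shell `Ω_r = {z ∈ 𝔹ₙ : |z| > r}`. -/
def shell (n : ℕ) (r : ℝ) : Set (EuclideanSpace ℂ (Fin n)) := {z ∈ unitBall n | r < ‖z‖}

/-- The normalized Lebesgue measure `dv = dm / Vol(𝔹ₙ)` on the unit ball. -/
noncomputable def normalizedVolume (n : ℕ) : Measure (EuclideanSpace ℂ (Fin n)) :=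
  (volume (unitBall n))⁻¹ • volume.restrict (unitBall n)

/-- The squared weighted norm `‖g‖_t² = ∫ |g(z)|² c_t (1 - |z|²)^t dv(z)` over the unit ball. -/
noncomputable def normSq (n t : ℕ) (g : EuclideanSpace ℂ (Fin n) → ℂ) : ℝ :=
  ∫ z, ‖g z‖ ^ 2 * c n t * (1 - ‖z‖ ^ 2) ^ t ∂(normalizedVolume n)

/-- The function on `ℂⁿ` given by an analytic polynomial. -/
noncomputable def evalAt {n : ℕ} (p : MvPolynomial (Fin n) ℂ) (z : EuclideanSpace ℂ (Fin n)) : ℂ :=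
  MvPolynomial.eval (fun i => z i) p

/-- The radial derivative `R p = ∑ zᵢ ∂ᵢ p`. -/
noncomputable def radial {n : ℕ} (p : MvPolynomial (Fin n) ℂ) : MvPolynomial (Fin n) ℂ :=
  ∑ i, MvPolynomial.X i * MvPolynomial.pderiv i p

/-- The complex tangential derivative `L_{j,i} p = conj(zᵢ) ∂ⱼ p - conj(zⱼ) ∂ᵢ p`; its values
are functions, in general not analytic. -/
noncomputable def tangential {n : ℕ} (j i : Fin n) (p : MvPolynomial (Fin n) ℂ)
    (z : EuclideanSpace ℂ (Fin n)) : ℂ :=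
  conj (z i) * evalAt (MvPolynomial.pderiv j p) z
    - conj (z j) * evalAt (MvPolynomial.pderiv i p) z

end PolyBergman

/-!
For a polynomial `q` of degree at most `m` in one variable and any polynomial `g`, the value
`q'(0) g(0)` is controlled by the mean square of `q g` over a disc about `0`: `q'` is the sum of the
quotients `q / (X - a)` over the roots `a` of `q`, and for each root the disc contains a concentric
annulus that stays away from `a`, on which dividing by `X - a` is harmless and the mean value
property applies (`norm_sq_derivative_mul_le_setIntegral`).

Restricted to the discs `z + η v(z)` with `|η|² < κ (1 - |z|²)^a`, where `v` is a vector field on the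
ball, and integrated over `z`, this bounds the derivative of `p` along `v` by `p`, with a gain of
`a` powers of the weight (`weightedSq_directional_le`). What is needed is that `1 - |·|²` is
comparable to `1 - |z|²` on the disc and that `z ↦ z + η v(z)` does not shrink volume. The
comparison costs a fixed factor per power of the weight, hence the constant `C ^ (k + 1)`. For `∂ⱼ`
the field is constant and `a = 2`; for `L_{j,i}` the field is `conj(zᵢ) eⱼ - conj(zⱼ) eᵢ`, which is
orthogonal to `z`, so that larger discs fit and `a = 1`. In both cases the discs exist about every
point of the ball, so the estimates hold over the whole ball and those over the shell follow.

Since `R = ∑ zᵢ ∂ᵢ`, the estimate for `R` follows from that for `∂ᵢ`. Iterating it `l` times would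
produce a constant of order `C ^ (k l)`. But by Euler's identity the numbers `R^l p (z)` are the
moments `∑ d ≤ m, d^l p_d(z)` of the homogeneous components, and these are controlled by the first
`m + 1` of them (`exists_norm_moment_le`), so at most `m` iterations are needed
(`exists_weightedSq_radial_iterate_le`).
-/

namespace PolyBergman

/-! ### Polynomials of one variable -/

/-- The half-open annulus `s ≤ |η| < r` about the origin of the complex plane. -/
def annulus (s r : ℝ) : Set ℂ := {η | s ≤ ‖η‖ ∧ ‖η‖ < r}

lemma annulus_subset_ball (s r : ℝ) : annulus s r ⊆ Metric.ball 0 r := fun η hη => by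
  simpa using hη.2

lemma measurableSet_annulus (s r : ℝ) : MeasurableSet (annulus s r) :=
  (measurableSet_le measurable_const measurable_norm).inter
    (measurableSet_lt measurable_norm measurable_const)

lemma integrableOn_ball_of_continuous {E F : Type*} [NormedAddCommGroup E] [ProperSpace E]
    [MeasurableSpace E] [OpensMeasurableSpace E] [NormedAddCommGroup F] {μ : Measure E}
    [IsFiniteMeasureOnCompacts μ] {u : E → F} (hu : Continuous u) (x : E) (r : ℝ) :
    IntegrableOn u (Metric.ball x r) μ :=
  (hu.continuousOn.integrableOn_compact (isCompact_closedBall x r)).mono_set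
    Metric.ball_subset_closedBall

lemma integrableOn_annulus_of_continuous {F : Type*} [NormedAddCommGroup F] {u : ℂ → F}
    (hu : Continuous u) (s r : ℝ) : IntegrableOn u (annulus s r) :=
  (integrableOn_ball_of_continuous hu 0 r).mono_set (annulus_subset_ball s r)

lemma setIntegral_annulus_pow_eq_zero (s r : ℝ) (n : ℕ) :
    ∫ η in annulus s r, η ^ (n + 1) = 0 := by
  -- the rotation by `ω`, where `ω ^ (n + 1) = -1`, preserves the annulus
  set ω : Circle := Circle.exp (Real.pi / (n + 1)) with hω
  have hpow : (ω : ℂ) ^ (n + 1) = -1 := by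
    rw [hω, Circle.coe_exp, ← Complex.exp_nat_mul, ← Complex.exp_pi_mul_I]
    congr 1
    have : (n : ℂ) + 1 ≠ 0 := by exact_mod_cast Nat.succ_ne_zero n
    push_cast
    field_simp
  have hmp := (rotation ω).measurePreserving
  have h := hmp.setIntegral_preimage_emb (rotation ω).toHomeomorph.measurableEmbedding
    (fun η : ℂ => η ^ (n + 1)) (annulus s r)
  have hpre : (rotation ω) ⁻¹' annulus s r = annulus s r := by
    ext η; simp [annulus, Circle.norm_coe]
  rw [hpre] at h
  simp only [rotation_apply, mul_pow, hpow, neg_mul, one_mul] at h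
  rw [integral_neg] at h
  exact self_eq_neg.mp h.symm

lemma setIntegral_annulus_eval (h : Polynomial ℂ) (s r : ℝ) :
    ∫ η in annulus s r, h.eval η = volume.real (annulus s r) • h.eval 0 := by
  induction h using Polynomial.induction_on' with
  | add p q hp hq =>
    simp only [Polynomial.eval_add]
    rw [integral_add (integrableOn_annulus_of_continuous p.continuous s r)
      (integrableOn_annulus_of_continuous q.continuous s r), hp, hq, smul_add]
  | monomial k a =>
    simp only [Polynomial.eval_monomial]
    rw [integral_const_mul]
    cases k with
    | zero => simp [mul_comm]
    | succ k => simp [setIntegral_annulus_pow_eq_zero]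

lemma norm_sq_eval_zero_mul_volume_le (h : Polynomial ℂ) (s r : ℝ) :
    volume.real (annulus s r) * ‖h.eval 0‖ ^ 2 ≤ ∫ η in annulus s r, ‖h.eval η‖ ^ 2 := by
  set w := h.eval 0 with hw
  set V := volume.real (annulus s r) with hV
  have hc := h.continuous
  have hi : IntegrableOn (fun η => conj w * h.eval η) (annulus s r) :=
    integrableOn_annulus_of_continuous (by fun_prop) s r
  -- integrate `2 Re (conj w * h) - |w|² ≤ |h|²`
  have key : ∫ η in annulus s r, (2 * (conj w * h.eval η).re - ‖w‖ ^ 2)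
      ≤ ∫ η in annulus s r, ‖h.eval η‖ ^ 2 := by
    refine integral_mono (integrableOn_annulus_of_continuous (by fun_prop) s r)
      (integrableOn_annulus_of_continuous (by fun_prop) s r) fun η => ?_
    have h0 : 0 ≤ ‖h.eval η - w‖ ^ 2 := by positivity
    rw [Complex.sq_norm, Complex.normSq_apply] at *
    simp only [Complex.sq_norm, Complex.normSq_apply, Complex.sub_re, Complex.sub_im,
      Complex.mul_re, Complex.conj_re, Complex.conj_im] at *
    nlinarith
  rw [integral_sub (integrableOn_annulus_of_continuous (by fun_prop) s r)
    (integrableOn_annulus_of_continuous (by fun_prop) s r), integral_const_mul] at key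
  have h2 : ∫ η in annulus s r, (conj w * h.eval η).re = V * ‖w‖ ^ 2 := by
    have h3 := integral_re (𝕜 := ℂ) hi
    simp only [RCLike.re_to_complex] at h3
    rw [h3, integral_const_mul, setIntegral_annulus_eval, ← hw, ← hV, Complex.sq_norm,
      Complex.real_smul, mul_left_comm, ← Complex.normSq_eq_conj_mul_self, ← Complex.ofReal_mul,
      Complex.ofReal_re]
  rw [h2, setIntegral_const, smul_eq_mul, ← hV] at key
  linarith

/-- Dividing by a linear factor: an annulus on which `|η - a| ≥ r / 4` exists wherever `a` is. -/
lemma norm_sq_eval_zero_le_setIntegral (h : Polynomial ℂ) (a : ℂ) {r : ℝ} (hr : 0 < r) :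
    ‖h.eval 0‖ ^ 2 * r ^ 4
      ≤ 1024 * ∫ η in Metric.ball 0 r, ‖(η - a) * h.eval η‖ ^ 2 := by
  have hc := h.continuous
  obtain ⟨s, t, ht, hfar, b, hb⟩ : ∃ s t : ℝ, t ≤ r ∧ (∀ η ∈ annulus s t, r / 4 ≤ ‖η - a‖) ∧
      ∃ b, Metric.ball b (r / 8) ⊆ annulus s t := by
    rcases le_total ‖a‖ (r / 2) with ha | ha
    · refine ⟨3 * r / 4, r, le_rfl, fun η hη => ?_, ((7 * r / 8 : ℝ) : ℂ), fun η hη => ?_⟩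
      · have := norm_sub_norm_le η a
        linarith [hη.1]
      · rw [mem_ball_iff_norm] at hη
        have h1 : ‖((7 * r / 8 : ℝ) : ℂ)‖ = 7 * r / 8 := by
          rw [Complex.norm_real, Real.norm_of_nonneg (by positivity)]
        have h2 := abs_lt.mp ((abs_norm_sub_norm_le η ((7 * r / 8 : ℝ) : ℂ)).trans_lt hη)
        rw [h1] at h2
        constructor <;> linarith
    · refine ⟨0, r / 4, by linarith, fun η hη => ?_, 0, fun η hη => ?_⟩
      · have := norm_sub_norm_le a η
        rw [norm_sub_rev] at this
        linarith [hη.2]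
      · rw [mem_ball_zero_iff] at hη
        exact ⟨norm_nonneg _, by linarith⟩
  have hsub : annulus s t ⊆ Metric.ball 0 r :=
    (annulus_subset_ball s t).trans (Metric.ball_subset_ball ht)
  have hvol : Real.pi * r ^ 2 / 64 ≤ volume.real (annulus s t) := by
    have h1 : volume.real (Metric.ball b (r / 8)) = Real.pi * r ^ 2 / 64 := by
      rw [measureReal_def, Complex.volume_ball, ENNReal.toReal_mul, ENNReal.toReal_pow,
        ENNReal.toReal_ofReal (by positivity), ENNReal.coe_toReal, NNReal.coe_real_pi]
      ring
    rw [← h1]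
    exact measureReal_mono hb ((measure_mono hsub).trans_lt measure_ball_lt_top).ne
  have h1 : ∫ η in annulus s t, (r / 4) ^ 2 * ‖h.eval η‖ ^ 2
      ≤ ∫ η in annulus s t, ‖(η - a) * h.eval η‖ ^ 2 := by
    refine setIntegral_mono_on (integrableOn_annulus_of_continuous (by fun_prop) s t)
      (integrableOn_annulus_of_continuous (by fun_prop) s t) (measurableSet_annulus s t)
      fun η hη => ?_
    rw [norm_mul, mul_pow]
    gcongr
    exact hfar η hη
  have h2 : ∫ η in annulus s t, ‖(η - a) * h.eval η‖ ^ 2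
      ≤ ∫ η in Metric.ball 0 r, ‖(η - a) * h.eval η‖ ^ 2 :=
    setIntegral_mono_set (integrableOn_ball_of_continuous (by fun_prop) 0 r)
      (Filter.Eventually.of_forall fun η => by positivity) hsub.eventuallyLE
  rw [integral_const_mul] at h1
  have h3 := norm_sq_eval_zero_mul_volume_le h s t
  have h4 : r ^ 2 / 64 * ‖h.eval 0‖ ^ 2 ≤ volume.real (annulus s t) * ‖h.eval 0‖ ^ 2 := by
    gcongr
    refine le_trans ?_ hvol
    have := Real.pi_gt_three
    nlinarith [sq_nonneg r]
  have h5 := mul_le_mul_of_nonneg_left (h4.trans h3) (by positivity : 0 ≤ (r / 4) ^ 2)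
  calc ‖h.eval 0‖ ^ 2 * r ^ 4
      = 1024 * ((r / 4) ^ 2 * (r ^ 2 / 64 * ‖h.eval 0‖ ^ 2)) := by ring
    _ ≤ 1024 * ∫ η in Metric.ball 0 r, ‖(η - a) * h.eval η‖ ^ 2 := by
        gcongr
        exact h5.trans (h1.trans h2)

/-- Local domination of the derivative of a polynomial `q` of degree at most `m` by `q` itself,
in the presence of an arbitrary polynomial factor `g`: `q'` is the sum of the at most `m`
quotients `q / (X - a)` over the roots `a` of `q`. -/
theorem norm_sq_derivative_mul_le_setIntegral (q g : Polynomial ℂ) {m : ℕ}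
    (hq : q.natDegree ≤ m) {r : ℝ} (hr : 0 < r) :
    ‖q.derivative.eval 0 * g.eval 0‖ ^ 2 * r ^ 4
      ≤ 1024 * m ^ 2 * ∫ η in Metric.ball 0 r, ‖q.eval η * g.eval η‖ ^ 2 := by
  classical
  set I := ∫ η in Metric.ball 0 r, ‖q.eval η * g.eval η‖ ^ 2 with hI
  have hI0 : 0 ≤ I := integral_nonneg fun η => by positivity
  set K := Real.sqrt (1024 * I / r ^ 4) with hK
  have hK2 : K ^ 2 * r ^ 4 = 1024 * I := by
    rw [hK, Real.sq_sqrt (by positivity)]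
    field_simp
  have hfac := (IsAlgClosed.splits q).eq_prod_roots
  set c := q.leadingCoeff
  set S := q.roots
  have hder : q.derivative.eval 0 * g.eval 0 = (S.map fun a =>
      ((Polynomial.C c * ((S.erase a).map fun x => Polynomial.X - Polynomial.C x).prod) * g).eval
        0).sum := by
    conv_lhs => rw [hfac]
    rw [Polynomial.derivative_C_mul, Polynomial.derivative_prod]
    simp only [Polynomial.derivative_X_sub_C, mul_one, Polynomial.eval_mul, Polynomial.eval_C]
    rw [← Polynomial.coe_evalRingHom, map_multiset_sum, Multiset.map_map, Multiset.sum_map_mul_right,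
      Multiset.sum_map_mul_left]
    rfl
  have hterm : ∀ a ∈ S, ‖((Polynomial.C c *
      ((S.erase a).map fun x => Polynomial.X - Polynomial.C x).prod) * g).eval 0‖ ≤ K := by
    intro a ha
    set h := (Polynomial.C c * ((S.erase a).map fun x => Polynomial.X - Polynomial.C x).prod) * g
      with hh
    have hqa : ∀ η, (η - a) * h.eval η = q.eval η * g.eval η := by
      intro η
      have : q * g = (Polynomial.X - Polynomial.C a) * h := by
        conv_lhs => rw [hfac, ← Multiset.cons_erase ha, Multiset.map_cons, Multiset.prod_cons]
        rw [hh]; ring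
      rw [← Polynomial.eval_mul, this]
      simp
    have := norm_sq_eval_zero_le_setIntegral h a hr
    simp only [hqa] at this
    rw [← hI, ← hK2] at this
    have h2 := le_of_mul_le_mul_right this (by positivity)
    exact (sq_le_sq₀ (norm_nonneg _) (Real.sqrt_nonneg _)).mp h2
  have hcard : (Multiset.card S : ℝ) ≤ m := by
    exact_mod_cast (Polynomial.card_roots' q).trans hq
  have hnorm : ‖q.derivative.eval 0 * g.eval 0‖ ≤ m * K := by
    rw [hder]
    refine (norm_multiset_sum_le _).trans ?_
    rw [Multiset.map_map]
    refine (Multiset.sum_le_card_nsmul _ K ?_).trans ?_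
    · intro x hx
      obtain ⟨a, ha, rfl⟩ := Multiset.mem_map.mp hx
      exact hterm a ha
    · rw [Multiset.card_map, nsmul_eq_mul]
      exact mul_le_mul_of_nonneg_right hcard (Real.sqrt_nonneg _)
  calc ‖q.derivative.eval 0 * g.eval 0‖ ^ 2 * r ^ 4 ≤ (m * K) ^ 2 * r ^ 4 := by gcongr
    _ = 1024 * m ^ 2 * I := by rw [mul_pow, mul_assoc, hK2]; ring

/-! ### Restriction of polynomials to complex lines -/

/-- The restriction `η ↦ p (z + η v)` of a polynomial to a complex line, as a polynomial in `η`. -/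
noncomputable def restrictLine {n : ℕ} (z v : EuclideanSpace ℂ (Fin n))
    (p : MvPolynomial (Fin n) ℂ) : Polynomial ℂ :=
  MvPolynomial.aeval (fun i => Polynomial.C (z i) + Polynomial.C (v i) * Polynomial.X) p

lemma eval_restrictLine {n : ℕ} (z v : EuclideanSpace ℂ (Fin n)) (p : MvPolynomial (Fin n) ℂ)
    (η : ℂ) : (restrictLine z v p).eval η = evalAt p (z + η • v) := by
  induction p using MvPolynomial.induction_on with
  | C a => simp [restrictLine, evalAt]
  | add p q hp hq => simp_all [restrictLine, evalAt]
  | mul_X p i hp =>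
    simp only [restrictLine, evalAt, map_mul, Polynomial.eval_mul] at hp ⊢
    rw [hp]
    simp [mul_comm η]

lemma natDegree_restrictLine_le {n m : ℕ} (z v : EuclideanSpace ℂ (Fin n))
    {p : MvPolynomial (Fin n) ℂ} (hp : p.totalDegree ≤ m) :
    (restrictLine z v p).natDegree ≤ m := by
  have := MvPolynomial.aeval_natDegree_le (n := 1) p hp
    (fun i => Polynomial.C (z i) + Polynomial.C (v i) * Polynomial.X) fun i => by
      rw [add_comm]
      exact Polynomial.natDegree_linear_le
  simpa [restrictLine] using this

lemma eval_zero_derivative_restrictLine {n : ℕ} (z v : EuclideanSpace ℂ (Fin n))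
    (p : MvPolynomial (Fin n) ℂ) :
    (restrictLine z v p).derivative.eval 0
      = ∑ i, v i * evalAt (MvPolynomial.pderiv i p) z := by
  induction p using MvPolynomial.induction_on with
  | C a => simp [restrictLine, evalAt]
  | add p q hp hq =>
    simp only [restrictLine, evalAt, map_add, Polynomial.eval_add] at hp hq ⊢
    rw [hp, hq, ← Finset.sum_add_distrib]
    simp only [mul_add]
  | mul_X p j hp =>
    have h0 := eval_restrictLine z v p 0
    simp only [restrictLine, evalAt, map_mul, Polynomial.derivative_mul, Polynomial.eval_add,
      Polynomial.eval_mul, Derivation.leibniz, smul_eq_mul, map_add] at hp h0 ⊢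
    rw [hp, h0]
    simp only [mul_add, Finset.sum_add_distrib, MvPolynomial.pderiv_X, MvPolynomial.eval_X,
      MvPolynomial.aeval_X]
    have hsingle : ∀ i, (MvPolynomial.eval fun i => z i)
        ((Pi.single i 1 : Fin n → MvPolynomial (Fin n) ℂ) j) = if j = i then 1 else 0 := fun i => by
      rw [Pi.single_apply]; split_ifs <;> simp
    simp only [hsingle, mul_ite, mul_one, mul_zero, Finset.sum_ite_eq, Finset.mem_univ, if_true]
    simp only [zero_smul, add_zero, Finset.sum_mul,
      Polynomial.derivative_add, Polynomial.derivative_C, Polynomial.derivative_C_mul,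
      Polynomial.derivative_X, Polynomial.eval_add, Polynomial.eval_mul, Polynomial.eval_C,
      Polynomial.eval_X, mul_zero, mul_one, zero_add]
    rw [add_comm, mul_comm (v j)]
    congr 1
    exact Finset.sum_congr rfl fun i _ => by ring

lemma continuous_evalAt {n : ℕ} (p : MvPolynomial (Fin n) ℂ) : Continuous (evalAt p) := by
  unfold evalAt
  induction p using MvPolynomial.induction_on with
  | C a => simpa using continuous_const
  | add p q hp hq => simp only [map_add]; exact hp.add hq
  | mul_X p i hp =>
    simp only [map_mul, MvPolynomial.eval_X]
    exact hp.mul (by fun_prop)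

lemma norm_sq_directional_mul_le_lintegral {n m : ℕ} {p : MvPolynomial (Fin n) ℂ}
    (hp : p.totalDegree ≤ m) (f : MvPolynomial (Fin n) ℂ) (z v : EuclideanSpace ℂ (Fin n))
    {r : ℝ} (hr : 0 < r) :
    ENNReal.ofReal
        (‖(∑ i, v i * evalAt (MvPolynomial.pderiv i p) z) * evalAt f z‖ ^ 2 * r ^ 4)
      ≤ ENNReal.ofReal (1024 * m ^ 2) * ∫⁻ η in Metric.ball (0 : ℂ) r,
          ENNReal.ofReal (‖evalAt p (z + η • v) * evalAt f (z + η • v)‖ ^ 2) := by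
  have h := norm_sq_derivative_mul_le_setIntegral (restrictLine z v p) (restrictLine z v f)
    (natDegree_restrictLine_le z v hp) hr
  simp only [eval_restrictLine, eval_zero_derivative_restrictLine, zero_smul, add_zero] at h
  have hcp := continuous_evalAt p
  have hcf := continuous_evalAt f
  rw [← ofReal_integral_eq_lintegral_ofReal
    (integrableOn_ball_of_continuous (by fun_prop) 0 r)
    (Filter.Eventually.of_forall fun η => by positivity), ← ENNReal.ofReal_mul (by positivity)]
  exact ENNReal.ofReal_le_ofReal h

/-! ### Averaging over discs -/

lemma lintegral_comp_linearMap_le {E : Type*} [NormedAddCommGroup E] [NormedSpace ℝ E]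
    [MeasurableSpace E] [BorelSpace E] [FiniteDimensional ℝ E] (μ : Measure E)
    [μ.IsAddHaarMeasure] (T : E →ₗ[ℝ] E) (hT : ∀ z, ‖z‖ ≤ ‖T z‖) {g : E → ENNReal}
    (hg : Measurable g) : ∫⁻ z, g (T z) ∂μ ≤ ∫⁻ z, g z ∂μ := by
  have hinj : Function.Injective T := by
    rw [injective_iff_map_eq_zero]
    intro z hz
    have := hT z
    rw [hz, norm_zero] at this
    exact norm_le_zero_iff.mp this
  have hdet : LinearMap.det T ≠ 0 := by
    have h := (LinearEquiv.ofInjectiveEndo T hinj).isUnit_det'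
    have h2 : ((LinearEquiv.ofInjectiveEndo T hinj : E ≃ₗ[ℝ] E) : E →ₗ[ℝ] E) = T := by
      ext; simp
    rw [h2] at h
    exact h.ne_zero
  -- the preimage of the unit ball lies in the unit ball, so the Jacobian is at least `1`
  have hscale : ENNReal.ofReal |(LinearMap.det T)⁻¹| ≤ 1 := by
    have h1 := Measure.addHaar_preimage_linearMap μ hdet (Metric.ball 0 1)
    have h2 : T ⁻¹' Metric.ball 0 1 ⊆ Metric.ball 0 1 := fun z hz => by
      simp only [Set.mem_preimage, mem_ball_zero_iff] at hz ⊢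
      exact (hT z).trans_lt hz
    have h3 := measure_mono (μ := μ) h2
    rw [h1] at h3
    have h4 : μ (Metric.ball 0 1) ≠ 0 := (Metric.measure_ball_pos μ 0 one_pos).ne'
    have h5 : μ (Metric.ball 0 1) ≠ ⊤ := measure_ball_lt_top.ne
    rw [← ENNReal.mul_le_mul_iff_left h4 h5, one_mul]
    exact h3
  have hTm : Measurable T := T.continuous_of_finiteDimensional.measurable
  rw [← lintegral_map hg hTm, Measure.map_linearMap_addHaar_eq_smul_addHaar μ hdet,
    lintegral_smul_measure, smul_eq_mul]
  exact mul_le_of_le_one_left' hscale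

/-- The weighted square integral `∫ |g|² (1 - |z|²)^t dm` over the unit ball, without
normalization and with values in `[0, ∞]`. -/
noncomputable def weightedSq (n t : ℕ) (g : EuclideanSpace ℂ (Fin n) → ℂ) : ENNReal :=
  ∫⁻ z in unitBall n, ENNReal.ofReal (‖g z‖ ^ 2 * (1 - ‖z‖ ^ 2) ^ t)

lemma mem_unitBall {n : ℕ} {z : EuclideanSpace ℂ (Fin n)} : z ∈ unitBall n ↔ ‖z‖ < 1 := by
  simp [unitBall]

lemma measurableSet_unitBall (n : ℕ) : MeasurableSet (unitBall n) := measurableSet_ball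

lemma one_sub_norm_sq_pos {n : ℕ} {z : EuclideanSpace ℂ (Fin n)} (hz : z ∈ unitBall n) :
    0 < 1 - ‖z‖ ^ 2 := by
  rw [mem_unitBall] at hz
  nlinarith [norm_nonneg z]

/-- The derivative of `p` along a vector field `v`, weighted by `(1 - |z|²)^(t + a)`, is dominated
by `p` itself with weight `(1 - |z|²)^t` as soon as the discs `z + η v(z)`,
`|η|² < κ (1 - |z|²)^a`, stay in the region where `1 - |·|²` is comparable to `1 - |z|²` and the
maps `z ↦ z + η v(z)` do not shrink volume. The one-variable estimate is applied on each of these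
discs, and the order of integration exchanged. -/
theorem weightedSq_directional_le {n m : ℕ} {p : MvPolynomial (Fin n) ℂ}
    (hp : p.totalDegree ≤ m) (f : MvPolynomial (Fin n) ℂ)
    {v : EuclideanSpace ℂ (Fin n) → EuclideanSpace ℂ (Fin n)} (hv : Continuous v)
    (a : ℕ) {κ : ℝ} (hκ : 0 < κ)
    (hvol : ∀ (η : ℂ) (g : EuclideanSpace ℂ (Fin n) → ENNReal), Measurable g →
      ∫⁻ z, g (z + η • v z) ≤ ∫⁻ z, g z)
    (hcmp : ∀ z ∈ unitBall n, ∀ η : ℂ, ‖η‖ ^ 2 < κ * (1 - ‖z‖ ^ 2) ^ a →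
      z + η • v z ∈ unitBall n ∧ 1 - ‖z‖ ^ 2 ≤ 4 * (1 - ‖z + η • v z‖ ^ 2) ∧
        1 - ‖z + η • v z‖ ^ 2 ≤ 4 * (1 - ‖z‖ ^ 2)) (t : ℕ) :
    weightedSq n (t + a)
        (fun z => (∑ i, v z i * evalAt (MvPolynomial.pderiv i p) z) * evalAt f z)
      ≤ ENNReal.ofReal (4096 * m ^ 2 * 16 ^ a / κ * 4 ^ t)
        * weightedSq n t (fun z => evalAt p z * evalAt f z) := by
  have hcp := continuous_evalAt p
  have hcf := continuous_evalAt f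
  set F : EuclideanSpace ℂ (Fin n) → ENNReal :=
    fun w => ENNReal.ofReal (‖evalAt p w * evalAt f w‖ ^ 2) with hF
  have hFm : Measurable F := by fun_prop
  set δ : EuclideanSpace ℂ (Fin n) → ℝ := fun w => 1 - ‖w‖ ^ 2 with hδ
  have hδm : Measurable δ := by fun_prop
  have hδ0 : ∀ w ∈ unitBall n, 0 < δ w := fun w hw => one_sub_norm_sq_pos hw
  -- `M * H (w, η)` bounds the contribution of `η` to the estimate at `z`, expressed entirely
  -- through `w = z + η v(z)`; the factor `4 ^ a` enlarges the disc about `z` to one about `w`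
  set A : Set (EuclideanSpace ℂ (Fin n) × ℂ) :=
    {x | x.1 ∈ unitBall n ∧ ‖x.2‖ ^ 2 < κ * 4 ^ a * δ x.1 ^ a} with hA
  have hAm : MeasurableSet A :=
    (measurable_fst (measurableSet_unitBall n)).inter
      (measurableSet_lt (f := fun x : EuclideanSpace ℂ (Fin n) × ℂ => ‖x.2‖ ^ 2)
        (g := fun x => κ * 4 ^ a * δ x.1 ^ a) (by fun_prop) (by fun_prop))
  set D : EuclideanSpace ℂ (Fin n) → ENNReal :=
    fun w => ENNReal.ofReal (4 ^ (t + a) / κ ^ 2 * (δ w ^ t / δ w ^ a)) * F w with hD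
  have hDm : Measurable D := by fun_prop
  set H : EuclideanSpace ℂ (Fin n) × ℂ → ENNReal := A.indicator fun x => D x.1 with hH
  have hHm : Measurable H := (hDm.comp measurable_fst).indicator hAm
  set M : ENNReal := ENNReal.ofReal (1024 * m ^ 2) with hM
  have hpoint : ∀ z ∈ unitBall n,
      ENNReal.ofReal (‖(∑ i, v z i * evalAt (MvPolynomial.pderiv i p) z) * evalAt f z‖ ^ 2
        * (1 - ‖z‖ ^ 2) ^ (t + a)) ≤ M * ∫⁻ η : ℂ, H (z + η • v z, η) := by
    intro z hz
    have hz0 := hδ0 z hz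
    set r := Real.sqrt (κ * δ z ^ a) with hr
    have hr0 : 0 < r := Real.sqrt_pos.mpr (by positivity)
    have hr2 : r ^ 2 = κ * δ z ^ a := Real.sq_sqrt (by positivity)
    have hloc := norm_sq_directional_mul_le_lintegral hp f z (v z) hr0
    have hsplit : ‖(∑ i, v z i * evalAt (MvPolynomial.pderiv i p) z) * evalAt f z‖ ^ 2
        * (1 - ‖z‖ ^ 2) ^ (t + a) = (δ z ^ t / δ z ^ a / κ ^ 2) *
        (‖(∑ i, v z i * evalAt (MvPolynomial.pderiv i p) z) * evalAt f z‖ ^ 2 * r ^ 4) := by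
      rw [show r ^ 4 = (r ^ 2) ^ 2 by ring, hr2, pow_add]
      change _ * (δ z ^ t * δ z ^ a) = _
      field_simp
    rw [hsplit, ENNReal.ofReal_mul (by positivity)]
    refine (mul_le_mul_right hloc _).trans ?_
    rw [mul_left_comm, ← lintegral_const_mul _ (by fun_prop)]
    refine mul_le_mul_right ((setLIntegral_mono' measurableSet_ball (g := fun η =>
      H (z + η • v z, η)) fun η hη => ?_).trans (setLIntegral_le_lintegral _ _)) _
    have hη2 : ‖η‖ ^ 2 < κ * (1 - ‖z‖ ^ 2) ^ a := by
      rw [mem_ball_zero_iff] at hη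
      calc ‖η‖ ^ 2 < r ^ 2 := by gcongr
        _ = _ := hr2
    obtain ⟨hw, h1, h2⟩ := hcmp z hz η hη2
    have hw0 := hδ0 _ hw
    have hmem : (z + η • v z, η) ∈ A := by
      refine ⟨hw, hη2.trans_le ?_⟩
      rw [mul_assoc, ← mul_pow]
      gcongr
    rw [hH, Set.indicator_of_mem hmem, hD]
    refine mul_le_mul_left (ENNReal.ofReal_le_ofReal ?_) _
    change δ z ≤ 4 * δ _ at h1
    change δ _ ≤ 4 * δ z at h2
    set w := z + η • v z
    have e1 : δ z ^ t ≤ 4 ^ t * δ w ^ t := by rw [← mul_pow]; gcongr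
    have e2 : δ w ^ a ≤ 4 ^ a * δ z ^ a := by rw [← mul_pow]; gcongr
    have e3 : δ z ^ t / δ z ^ a ≤ 4 ^ (t + a) * (δ w ^ t / δ w ^ a) := by
      rw [← mul_div_assoc, div_le_div_iff₀ (by positivity) (by positivity)]
      calc δ z ^ t * δ w ^ a ≤ (4 ^ t * δ w ^ t) * (4 ^ a * δ z ^ a) := by gcongr
        _ = _ := by ring
    calc δ z ^ t / δ z ^ a / κ ^ 2 ≤ 4 ^ (t + a) * (δ w ^ t / δ w ^ a) / κ ^ 2 := by gcongr
      _ = _ := by ring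
  -- the area of the disc cancels the factor `(1 - |w|²)^(-a)`
  have hinner : ∀ w, ∫⁻ η : ℂ, H (w, η) ≤ (unitBall n).indicator (fun w =>
      ENNReal.ofReal (4 * 16 ^ a / κ * 4 ^ t) * ENNReal.ofReal
        (‖evalAt p w * evalAt f w‖ ^ 2 * (1 - ‖w‖ ^ 2) ^ t)) w := by
    intro w
    by_cases hw : w ∈ unitBall n
    · have hw0 := hδ0 w hw
      rw [Set.indicator_of_mem hw]
      have hHw : (fun η : ℂ => H (w, η)) =
          (Metric.ball (0 : ℂ) (Real.sqrt (κ * 4 ^ a * δ w ^ a))).indicator fun _ => D w := by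
        funext η
        rw [hH]
        have : (w, η) ∈ A ↔ η ∈ Metric.ball (0 : ℂ) (Real.sqrt (κ * 4 ^ a * δ w ^ a)) := by
          rw [mem_ball_zero_iff, Real.lt_sqrt (norm_nonneg _)]
          exact ⟨fun h => h.2, fun h => ⟨hw, h⟩⟩
        by_cases h : (w, η) ∈ A
        · rw [Set.indicator_of_mem h, Set.indicator_of_mem (this.mp h)]
        · rw [Set.indicator_of_notMem h, Set.indicator_of_notMem (mt this.mpr h)]
      rw [hHw, lintegral_indicator measurableSet_ball, setLIntegral_const, Complex.volume_ball,
        ← ENNReal.ofReal_pow (Real.sqrt_nonneg _), Real.sq_sqrt (by positivity),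
        show ((NNReal.pi : NNReal) : ENNReal) = ENNReal.ofReal Real.pi by
          rw [← NNReal.coe_real_pi, ENNReal.ofReal_coe_nnreal], hD, hF]
      simp only
      rw [← ENNReal.ofReal_mul (by positivity), ← ENNReal.ofReal_mul (by positivity),
        ← ENNReal.ofReal_mul (by positivity), ← ENNReal.ofReal_mul (by positivity)]
      refine ENNReal.ofReal_le_ofReal ?_
      change _ ≤ _ * (_ * δ w ^ t)
      have h16 : (16 : ℝ) ^ a = 4 ^ a * 4 ^ a := by rw [← mul_pow]; norm_num
      calc _ = Real.pi * (16 ^ a / κ * 4 ^ t * (‖evalAt p w * evalAt f w‖ ^ 2 * δ w ^ t)) := by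
            rw [h16, pow_add]; field_simp
        _ ≤ 4 * (16 ^ a / κ * 4 ^ t * (‖evalAt p w * evalAt f w‖ ^ 2 * δ w ^ t)) := by
            gcongr; exact Real.pi_le_four
        _ = _ := by ring
    · have : ∀ η : ℂ, H (w, η) = 0 := fun η =>
        Set.indicator_of_notMem (fun h => hw h.1) _
      simp [this]
  calc weightedSq n (t + a)
        (fun z => (∑ i, v z i * evalAt (MvPolynomial.pderiv i p) z) * evalAt f z)
      ≤ ∫⁻ z in unitBall n, M * ∫⁻ η : ℂ, H (z + η • v z, η) :=
        setLIntegral_mono' (measurableSet_unitBall n) hpoint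
    _ ≤ ∫⁻ z, M * ∫⁻ η : ℂ, H (z + η • v z, η) := setLIntegral_le_lintegral _ _
    _ = M * ∫⁻ z, ∫⁻ η : ℂ, H (z + η • v z, η) := lintegral_const_mul' _ _ ENNReal.ofReal_ne_top
    _ = M * ∫⁻ η : ℂ, ∫⁻ z, H (z + η • v z, η) := by
        rw [lintegral_lintegral_swap]
        exact (hHm.comp (by fun_prop)).aemeasurable
    _ ≤ M * ∫⁻ η : ℂ, ∫⁻ w, H (w, η) := by
        refine mul_le_mul_right (lintegral_mono fun η => ?_) _
        exact hvol η (fun w => H (w, η)) (by fun_prop)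
    _ = M * ∫⁻ w, ∫⁻ η : ℂ, H (w, η) := by
        rw [lintegral_lintegral_swap]
        exact (hHm.comp (by fun_prop)).aemeasurable
    _ ≤ M * ∫⁻ w in unitBall n, ENNReal.ofReal (4 * 16 ^ a / κ * 4 ^ t) * ENNReal.ofReal
        (‖evalAt p w * evalAt f w‖ ^ 2 * (1 - ‖w‖ ^ 2) ^ t) := by
        rw [← lintegral_indicator (measurableSet_unitBall n)]
        gcongr with w
        exact hinner w
    _ = _ := by
        rw [lintegral_const_mul' _ _ ENNReal.ofReal_ne_top, ← mul_assoc, hM,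
          ← ENNReal.ofReal_mul (by positivity)]
        congr 2
        ring

/-! ### Coordinate and tangential derivatives -/

theorem weightedSq_pderiv_mul_le {n m : ℕ} {p : MvPolynomial (Fin n) ℂ}
    (hp : p.totalDegree ≤ m) (f : MvPolynomial (Fin n) ℂ) (j : Fin n) (t : ℕ) :
    weightedSq n (t + 2) (fun z => evalAt (MvPolynomial.pderiv j p) z * evalAt f z)
      ≤ ENNReal.ofReal (2 ^ 24 * m ^ 2 * 4 ^ t)
        * weightedSq n t (fun z => evalAt p z * evalAt f z) := by
  have h := weightedSq_directional_le hp f (v := fun _ => EuclideanSpace.single j (1 : ℂ))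
    continuous_const 2 (κ := 1 / 16) (by norm_num)
    (fun η g _ => (lintegral_add_right_eq_self g _).le) (fun z hz η hη => by
      rw [mem_unitBall] at hz
      have hz0 := norm_nonneg z
      have hη0 := norm_nonneg η
      have hδ : 0 < 1 - ‖z‖ ^ 2 := by nlinarith
      have hη1 : ‖η‖ < (1 - ‖z‖ ^ 2) / 4 :=
        lt_of_pow_lt_pow_left₀ 2 (by positivity) (by linarith)
      have hdist : |‖z + η • EuclideanSpace.single j (1 : ℂ)‖ - ‖z‖| ≤ ‖η‖ := by
        refine (abs_norm_sub_norm_le _ _).trans ?_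
        rw [add_sub_cancel_left, norm_smul]
        simp
      set w := z + η • EuclideanSpace.single j (1 : ℂ)
      have hw0 := norm_nonneg w
      obtain ⟨h1, h2⟩ := abs_le.mp hdist
      have hw1 : ‖w‖ < 1 := by nlinarith
      refine ⟨mem_unitBall.mpr hw1, ?_, ?_⟩ <;> nlinarith) t
  simp only [PiLp.single_apply, ite_mul, one_mul, zero_mul, Finset.sum_ite_eq',
    Finset.mem_univ, if_true] at h
  refine h.trans_eq ?_
  congr 2
  ring

/-- The vector field `conj(zᵢ) eⱼ - conj(zⱼ) eᵢ`, along which `L_{j,i}` differentiates. -/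
noncomputable def tangentField {n : ℕ} (j i : Fin n) (z : EuclideanSpace ℂ (Fin n)) :
    EuclideanSpace ℂ (Fin n) :=
  conj (z i) • EuclideanSpace.single j (1 : ℂ) - conj (z j) • EuclideanSpace.single i (1 : ℂ)

lemma sum_tangentField_mul {n : ℕ} (j i : Fin n) (p : MvPolynomial (Fin n) ℂ)
    (z : EuclideanSpace ℂ (Fin n)) :
    ∑ k, tangentField j i z k * evalAt (MvPolynomial.pderiv k p) z = tangential j i p z := by
  simp [tangentField, tangential, sub_mul, Finset.sum_sub_distrib, PiLp.single_apply]

lemma norm_add_smul_tangentField_sq {n : ℕ} (j i : Fin n) (z : EuclideanSpace ℂ (Fin n))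
    (η : ℂ) : ‖z + η • tangentField j i z‖ ^ 2
      = ‖z‖ ^ 2 + ‖η‖ ^ 2 * ‖tangentField j i z‖ ^ 2 := by
  have h0 : inner ℂ z (tangentField j i z) = 0 := by
    simp [tangentField, EuclideanSpace.inner_single_right, mul_comm]
  rw [norm_add_sq (𝕜 := ℂ), inner_smul_right, h0, norm_smul, mul_pow]
  simp

lemma norm_tangentField_le {n : ℕ} (j i : Fin n) (z : EuclideanSpace ℂ (Fin n)) :
    ‖tangentField j i z‖ ≤ 2 * ‖z‖ := by
  refine (norm_sub_le _ _).trans ?_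
  have h1 := PiLp.norm_apply_le z i
  have h2 := PiLp.norm_apply_le z j
  simp only [norm_smul, RCLike.norm_conj, PiLp.norm_single, norm_one, mul_one]
  linarith

/-- The tangential discs `z + η v(z)` may be taken of radius comparable to `(1 - |z|²)^(1/2)`,
because `v(z)` is orthogonal to `z`; this is why only one power of the weight is gained. -/
theorem weightedSq_tangential_mul_le {n m : ℕ} {p : MvPolynomial (Fin n) ℂ}
    (hp : p.totalDegree ≤ m) (f : MvPolynomial (Fin n) ℂ) (j i : Fin n) (t : ℕ) :
    weightedSq n (t + 1) (fun z => tangential j i p z * evalAt f z)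
      ≤ ENNReal.ofReal (2 ^ 24 * m ^ 2 * 4 ^ t)
        * weightedSq n t (fun z => evalAt p z * evalAt f z) := by
  have h := weightedSq_directional_le hp f (v := tangentField j i)
    (by unfold tangentField; fun_prop) 1 (κ := 1 / 8) (by norm_num)
    (fun η g hg => by
      let T : EuclideanSpace ℂ (Fin n) →ₗ[ℝ] EuclideanSpace ℂ (Fin n) :=
        { toFun := fun z => z + η • tangentField j i z
          map_add' := fun x y => by
            ext k
            simp [tangentField]
            split_ifs <;> ring
          map_smul' := fun a x => by
            ext k
            simp [tangentField]
            split_ifs <;> ring }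
      refine lintegral_comp_linearMap_le volume T (fun z => ?_) hg
      refine le_of_sq_le_sq ?_ (norm_nonneg _)
      change ‖z‖ ^ 2 ≤ ‖z + η • tangentField j i z‖ ^ 2
      rw [norm_add_smul_tangentField_sq]
      have : 0 ≤ ‖η‖ ^ 2 * ‖tangentField j i z‖ ^ 2 := by positivity
      linarith)
    (fun z hz η hη => by
      have hz1 := mem_unitBall.mp hz
      have hδ := one_sub_norm_sq_pos hz
      have hv : ‖tangentField j i z‖ ^ 2 ≤ 2 ^ 2 := by
        have := norm_tangentField_le j i z
        gcongr
        linarith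
      have hprod : ‖η‖ ^ 2 * ‖tangentField j i z‖ ^ 2 ≤ (1 - ‖z‖ ^ 2) / 2 := by
        calc _ ≤ (1 / 8 * (1 - ‖z‖ ^ 2) ^ 1) * 2 ^ 2 := by gcongr
          _ = _ := by ring
      have h0 : 0 ≤ ‖η‖ ^ 2 * ‖tangentField j i z‖ ^ 2 := by positivity
      rw [mem_unitBall, ← sq_lt_one_iff₀ (norm_nonneg _), norm_add_smul_tangentField_sq]
      refine ⟨?_, ?_, ?_⟩ <;> linarith) t
  simp only [sum_tangentField_mul] at h
  refine h.trans ?_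
  gcongr ?_ * _
  refine ENNReal.ofReal_le_ofReal ?_
  have : (0 : ℝ) ≤ m ^ 2 * 4 ^ t := by positivity
  linarith

/-! ### Iterated radial derivatives -/

lemma radial_sum {n : ℕ} {ι : Type*} (s : Finset ι) (g : ι → MvPolynomial (Fin n) ℂ) :
    radial (∑ d ∈ s, g d) = ∑ d ∈ s, radial (g d) := by
  simp only [radial, map_sum, Finset.mul_sum]
  exact Finset.sum_comm

lemma radial_smul {n : ℕ} (a : ℂ) (p : MvPolynomial (Fin n) ℂ) :
    radial (a • p) = a • radial p := by
  simp [radial, Finset.smul_sum]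

/-- Euler's identity: `R` multiplies the homogeneous component of degree `d` by `d`. -/
lemma radial_iterate_eq_sum {n m : ℕ} {p : MvPolynomial (Fin n) ℂ} (hp : p.totalDegree ≤ m)
    (l : ℕ) : radial^[l] p
      = ∑ d ∈ Finset.range (m + 1), (d : ℂ) ^ l • MvPolynomial.homogeneousComponent d p := by
  induction l with
  | zero =>
    simp only [Function.iterate_zero, id, pow_zero, one_smul]
    conv_lhs => rw [← MvPolynomial.sum_homogeneousComponent p]
    refine Finset.sum_subset (Finset.range_subset_range.mpr (by omega)) fun d _ hd => ?_
    refine MvPolynomial.homogeneousComponent_eq_zero d p ?_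
    have := Finset.mem_range.not.mp hd
    omega
  | succ l ih =>
    rw [Function.iterate_succ_apply', ih, radial_sum]
    refine Finset.sum_congr rfl fun d _ => ?_
    rw [radial_smul, radial,
      (MvPolynomial.homogeneousComponent_isHomogeneous d p).sum_X_mul_pderiv, pow_succ, mul_smul,
      Nat.cast_smul_eq_nsmul]

lemma totalDegree_radial_iterate_le {n m : ℕ} {p : MvPolynomial (Fin n) ℂ}
    (hp : p.totalDegree ≤ m) (l : ℕ) : (radial^[l] p).totalDegree ≤ m := by
  rw [radial_iterate_eq_sum hp]
  refine MvPolynomial.totalDegree_finsetSum_le fun d hd => ?_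
  refine (MvPolynomial.totalDegree_smul_le _ _).trans ?_
  refine (MvPolynomial.homogeneousComponent_isHomogeneous d p).totalDegree_le.trans ?_
  have := Finset.mem_range.mp hd
  omega

/-- The moments `∑ d ≤ m, d ^ l * h d` with `l ≤ m` determine `h`, by Lagrange interpolation at
`0, …, m`, and so control all the moments. -/
lemma exists_norm_moment_le (m : ℕ) : ∃ B : ℝ, 1 ≤ B ∧ ∀ (h : ℕ → ℂ) (l : ℕ),
    ‖∑ d ∈ Finset.range (m + 1), (d : ℂ) ^ l * h d‖
      ≤ B * (m : ℝ) ^ l * ∑ s ∈ Finset.range (m + 1),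
          ‖∑ d ∈ Finset.range (m + 1), (d : ℂ) ^ s * h d‖ := by
  set S := Finset.range (m + 1) with hS
  set L : ℕ → Polynomial ℂ := fun d => Lagrange.basis S (fun e : ℕ => (e : ℂ)) d with hL
  have hinj : Set.InjOn (fun e : ℕ => (e : ℂ)) S := fun a _ b _ hab => Nat.cast_injective hab
  set c : ℝ := ∑ d ∈ S, ∑ s ∈ S, ‖(L d).coeff s‖ with hc
  have hc0 : 0 ≤ c := by positivity
  refine ⟨1 + c, by linarith, fun h l => ?_⟩
  set u : ℕ → ℂ := fun s => ∑ d ∈ S, (d : ℂ) ^ s * h d with hu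
  set U := ∑ s ∈ S, ‖u s‖ with hU
  have hU0 : 0 ≤ U := by positivity
  have hh : ∀ d ∈ S, h d = ∑ s ∈ S, (L d).coeff s * u s := by
    intro d hd
    have hdeg : (L d).natDegree < m + 1 := by
      rw [hL]
      simp only
      rw [Polynomial.natDegree_lt_iff_degree_lt (Lagrange.basis_ne_zero hinj hd),
        Lagrange.degree_basis hinj hd, hS, Finset.card_range]
      exact_mod_cast Nat.lt_succ_self m
    calc h d = ∑ e ∈ S, (L d).eval (e : ℂ) * h e := by
          rw [Finset.sum_eq_single_of_mem d hd]
          · rw [show (L d).eval (d : ℂ) = 1 from Lagrange.eval_basis_self hinj hd, one_mul]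
          · intro e he hed
            rw [show (L d).eval (e : ℂ) = 0 from Lagrange.eval_basis_of_ne (Ne.symm hed) he,
              zero_mul]
      _ = ∑ e ∈ S, ∑ s ∈ S, (L d).coeff s * ((e : ℂ) ^ s * h e) := by
          refine Finset.sum_congr rfl fun e _ => ?_
          rw [Polynomial.eval_eq_sum_range' hdeg, Finset.sum_mul]
          exact Finset.sum_congr rfl fun s _ => by ring
      _ = _ := by
          rw [Finset.sum_comm]
          exact Finset.sum_congr rfl fun s _ => by rw [hu, Finset.mul_sum]
  calc ‖u l‖ ≤ ∑ d ∈ S, ‖(d : ℂ) ^ l * h d‖ := norm_sum_le _ _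
    _ ≤ ∑ d ∈ S, (m : ℝ) ^ l * ((∑ s ∈ S, ‖(L d).coeff s‖) * U) := by
        refine Finset.sum_le_sum fun d hd => ?_
        rw [norm_mul, norm_pow, Complex.norm_natCast]
        have hdm : d ≤ m := Nat.lt_succ_iff.mp (Finset.mem_range.mp hd)
        gcongr
        rw [hh d hd, Finset.sum_mul]
        refine (norm_sum_le _ _).trans (Finset.sum_le_sum fun s hs => ?_)
        rw [norm_mul]
        gcongr
        exact Finset.single_le_sum (f := fun s => ‖u s‖) (fun _ _ => norm_nonneg _) hs
    _ = c * (m : ℝ) ^ l * U := by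
        rw [← Finset.mul_sum, ← Finset.sum_mul, ← hc]
        ring
    _ ≤ (1 + c) * (m : ℝ) ^ l * U := by
        gcongr
        linarith

lemma weightedSq_antitone {n : ℕ} {s t : ℕ} (hst : s ≤ t) (g : EuclideanSpace ℂ (Fin n) → ℂ) :
    weightedSq n t g ≤ weightedSq n s g := by
  refine setLIntegral_mono' (measurableSet_unitBall n) fun z hz => ENNReal.ofReal_le_ofReal ?_
  have h := one_sub_norm_sq_pos hz
  gcongr ?_ * ?_
  exact pow_le_pow_of_le_one h.le (by nlinarith [norm_nonneg z]) hst

lemma weightedSq_le_sum {n t : ℕ} {ι : Type*} (s : Finset ι) {b : ℝ} (hb : 0 ≤ b)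
    {g : EuclideanSpace ℂ (Fin n) → ℂ} {G : ι → EuclideanSpace ℂ (Fin n) → ℂ}
    (hG : ∀ i ∈ s, Measurable (G i))
    (hgG : ∀ z ∈ unitBall n, ‖g z‖ ^ 2 ≤ b * ∑ i ∈ s, ‖G i z‖ ^ 2) :
    weightedSq n t g ≤ ENNReal.ofReal b * ∑ i ∈ s, weightedSq n t (G i) := by
  have hm : ∀ i ∈ s, Measurable fun z : EuclideanSpace ℂ (Fin n) =>
      ENNReal.ofReal (‖G i z‖ ^ 2 * (1 - ‖z‖ ^ 2) ^ t) := fun i hi => by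
    have := hG i hi
    fun_prop
  unfold weightedSq
  rw [← lintegral_finsetSum' _ fun i hi => (hm i hi).aemeasurable,
    ← lintegral_const_mul' _ _ ENNReal.ofReal_ne_top]
  refine setLIntegral_mono' (measurableSet_unitBall n) fun z hz => ?_
  have h := one_sub_norm_sq_pos hz
  rw [← ENNReal.ofReal_sum_of_nonneg fun i _ => by positivity, ← ENNReal.ofReal_mul hb]
  refine ENNReal.ofReal_le_ofReal ?_
  rw [← Finset.sum_mul, ← mul_assoc]
  gcongr
  exact hgG z hz

lemma weightedSq_radial_mul_le {n m : ℕ} {p : MvPolynomial (Fin n) ℂ}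
    (hp : p.totalDegree ≤ m) (f : MvPolynomial (Fin n) ℂ) (t : ℕ) :
    weightedSq n (t + 2) (fun z => evalAt (radial p) z * evalAt f z)
      ≤ ENNReal.ofReal (2 ^ 24 * n ^ 2 * m ^ 2 * 4 ^ t)
        * weightedSq n t (fun z => evalAt p z * evalAt f z) := by
  refine (weightedSq_le_sum Finset.univ (Nat.cast_nonneg n)
    (G := fun i z => evalAt (MvPolynomial.pderiv i p) z * evalAt f z)
    (fun i _ => ((continuous_evalAt _).mul (continuous_evalAt f)).measurable)
    fun z hz => ?_).trans ?_
  · have hev : evalAt (radial p) z = ∑ i, z i * evalAt (MvPolynomial.pderiv i p) z := by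
      simp [evalAt, radial]
    have hz1 := (mem_unitBall.mp hz).le
    calc ‖evalAt (radial p) z * evalAt f z‖ ^ 2
        ≤ (∑ i, ‖evalAt (MvPolynomial.pderiv i p) z * evalAt f z‖) ^ 2 := by
          gcongr
          rw [hev, Finset.sum_mul]
          refine (norm_sum_le _ _).trans (Finset.sum_le_sum fun i _ => ?_)
          rw [mul_assoc, norm_mul]
          exact mul_le_of_le_one_left (norm_nonneg _) ((PiLp.norm_apply_le z i).trans hz1)
      _ ≤ n * ∑ i, ‖evalAt (MvPolynomial.pderiv i p) z * evalAt f z‖ ^ 2 := by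
          refine sq_sum_le_card_mul_sum_sq.trans_eq ?_
          simp
  · refine (mul_le_mul_right (Finset.sum_le_sum fun i _ =>
      weightedSq_pderiv_mul_le hp f i t) _).trans_eq ?_
    rw [Finset.sum_const, Finset.card_univ, Fintype.card_fin, nsmul_eq_mul, ← mul_assoc,
      ← mul_assoc, ← ENNReal.ofReal_natCast n, ← ENNReal.ofReal_mul (by positivity),
      ← ENNReal.ofReal_mul (by positivity)]
    congr 2
    ring

lemma weightedSq_radial_iterate_mul_le {n m : ℕ} {p : MvPolynomial (Fin n) ℂ}
    (hp : p.totalDegree ≤ m) (f : MvPolynomial (Fin n) ℂ) (t s : ℕ) :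
    weightedSq n (t + 2 * s) (fun z => evalAt (radial^[s] p) z * evalAt f z)
      ≤ ENNReal.ofReal ((2 ^ 24 * n ^ 2 * m ^ 2 * 4 ^ (t + 2 * s)) ^ s)
        * weightedSq n t (fun z => evalAt p z * evalAt f z) := by
  induction s with
  | zero => simp
  | succ s ih =>
    rw [Function.iterate_succ_apply']
    refine (weightedSq_radial_mul_le (totalDegree_radial_iterate_le hp s) f (t + 2 * s)).trans ?_
    refine (mul_le_mul_right ih _).trans ?_
    rw [← mul_assoc, ← ENNReal.ofReal_mul (by positivity)]
    gcongr ?_ * _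
    refine ENNReal.ofReal_le_ofReal ?_
    rw [pow_succ' _ s, show t + 2 * (s + 1) = t + 2 * s + 2 by ring]
    have h4 : (4 : ℝ) ^ (t + 2 * s) ≤ 4 ^ (t + 2 * s + 2) :=
      pow_le_pow_right₀ (by norm_num) (by omega)
    have hbase := mul_le_mul_of_nonneg_left h4
      (by positivity : (0 : ℝ) ≤ 2 ^ 24 * n ^ 2 * m ^ 2)
    exact mul_le_mul hbase (pow_le_pow_left₀ (by positivity) hbase s) (by positivity)
      (by positivity)

/-- The number of radial derivatives is unbounded but `R` has at most `m + 1` eigenvalues on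
polynomials of degree at most `m`; so `R^l p` reduces to `R^s p` with `s ≤ m`, at the cost of a
factor exponential in `l`, and the first order estimate is iterated at most `m` times. -/
theorem exists_weightedSq_radial_iterate_le (n m : ℕ) (hn : 1 ≤ n) (hm : 1 ≤ m) :
    ∃ B : ℝ, 1 ≤ B ∧ ∀ p : MvPolynomial (Fin n) ℂ, p.totalDegree ≤ m →
      ∀ (f : MvPolynomial (Fin n) ℂ) (k l : ℕ), l ≤ k →
        weightedSq n (2 * k) (fun z => evalAt (radial^[l] p) z * evalAt f z)
          ≤ ENNReal.ofReal (B * (m ^ 2) ^ k * (2 ^ 24 * n ^ 2 * m ^ 2 * 16 ^ k) ^ m)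
            * weightedSq n (2 * k - 2 * l) (fun z => evalAt p z * evalAt f z) := by
  obtain ⟨B, hB, hmom⟩ := exists_norm_moment_le m
  have hn' : (1 : ℝ) ≤ n := by exact_mod_cast hn
  have hm' : (1 : ℝ) ≤ m := by exact_mod_cast hm
  refine ⟨B ^ 2 * (m + 1) ^ 2, one_le_mul_of_one_le_of_one_le (one_le_pow₀ hB)
    (one_le_pow₀ (by linarith)), fun p hp f k l hlk => ?_⟩
  set P : ENNReal := weightedSq n (2 * k - 2 * l) (fun z => evalAt p z * evalAt f z)
  set A : ℝ := 2 ^ 24 * n ^ 2 * m ^ 2 * 16 ^ k with hA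
  have hA1 : 1 ≤ A := by
    have h1 : (1 : ℝ) ≤ 16 ^ k := one_le_pow₀ (by norm_num)
    have h2 : (1 : ℝ) ≤ n ^ 2 := one_le_pow₀ hn'
    have h3 : (1 : ℝ) ≤ m ^ 2 := one_le_pow₀ hm'
    rw [hA]
    refine one_le_mul_of_one_le_of_one_le (one_le_mul_of_one_le_of_one_le ?_ h3) h1
    linarith
  have hlow : ∀ s, s ≤ m → s ≤ l →
      weightedSq n (2 * k) (fun z => evalAt (radial^[s] p) z * evalAt f z)
        ≤ ENNReal.ofReal (A ^ m) * P := by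
    intro s hsm hsl
    have h := weightedSq_radial_iterate_mul_le hp f (2 * k - 2 * s) s
    rw [show 2 * k - 2 * s + 2 * s = 2 * k by omega, pow_mul,
      show ((4 : ℝ) ^ 2) = 16 by norm_num, ← hA] at h
    refine h.trans ?_
    gcongr ?_ * ?_
    · exact ENNReal.ofReal_le_ofReal (pow_le_pow_right₀ hA1 hsm)
    · exact weightedSq_antitone (by omega) _
  have hmk : (1 : ℝ) ≤ (m ^ 2) ^ k := one_le_pow₀ (one_le_pow₀ hm')
  rcases le_or_gt l m with hlm | hlm
  · refine (hlow l hlm le_rfl).trans ?_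
    gcongr ?_ * _
    refine ENNReal.ofReal_le_ofReal (le_mul_of_one_le_left (by positivity) ?_)
    exact one_le_mul_of_one_le_of_one_le (one_le_mul_of_one_le_of_one_le (one_le_pow₀ hB)
      (one_le_pow₀ (by linarith))) hmk
  · have hval : ∀ (z : EuclideanSpace ℂ (Fin n)) (s : ℕ),
        evalAt (radial^[s] p) z = ∑ d ∈ Finset.range (m + 1),
          (d : ℂ) ^ s * evalAt (MvPolynomial.homogeneousComponent d p) z := by
      intro z s
      rw [radial_iterate_eq_sum hp]
      simp [evalAt, MvPolynomial.smul_eval]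
    refine (weightedSq_le_sum (Finset.range (m + 1)) (b := B ^ 2 * (m ^ 2) ^ k * (m + 1))
      (by positivity) (G := fun s z => evalAt (radial^[s] p) z * evalAt f z)
      (fun s _ => ((continuous_evalAt _).mul (continuous_evalAt f)).measurable)
      fun z _ => ?_).trans ?_
    · have h1 : ‖evalAt (radial^[l] p) z‖
          ≤ B * m ^ k * ∑ s ∈ Finset.range (m + 1), ‖evalAt (radial^[s] p) z‖ := by
        simp only [hval]
        refine (hmom _ l).trans ?_
        gcongr
      calc ‖evalAt (radial^[l] p) z * evalAt f z‖ ^ 2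
          = ‖evalAt (radial^[l] p) z‖ ^ 2 * ‖evalAt f z‖ ^ 2 := by rw [norm_mul, mul_pow]
        _ ≤ (B * m ^ k * ∑ s ∈ Finset.range (m + 1), ‖evalAt (radial^[s] p) z‖) ^ 2
            * ‖evalAt f z‖ ^ 2 := by gcongr
        _ ≤ B ^ 2 * (m ^ 2) ^ k * ((m + 1 : ℕ) * ∑ s ∈ Finset.range (m + 1),
            ‖evalAt (radial^[s] p) z‖ ^ 2) * ‖evalAt f z‖ ^ 2 := by
            rw [mul_pow, mul_pow, ← pow_mul, mul_comm k 2, pow_mul]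
            gcongr
            have := sq_sum_le_card_mul_sum_sq (s := Finset.range (m + 1))
              (f := fun s => ‖evalAt (radial^[s] p) z‖)
            rwa [Finset.card_range] at this
        _ = _ := by
            simp only [norm_mul, mul_pow, ← Finset.sum_mul]
            push_cast
            ring
    · refine (mul_le_mul_right (Finset.sum_le_sum fun s hs =>
        hlow s (Nat.lt_succ_iff.mp (Finset.mem_range.mp hs)) ?_) _).trans_eq ?_
      · exact (Nat.lt_succ_iff.mp (Finset.mem_range.mp hs)).trans hlm.le
      · rw [Finset.sum_const, Finset.card_range, nsmul_eq_mul, ← mul_assoc, ← mul_assoc,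
          ← ENNReal.ofReal_natCast, ← ENNReal.ofReal_mul (by positivity),
          ← ENNReal.ofReal_mul (by positivity)]
        congr 2
        push_cast
        ring

/-- The three estimates with a common constant, for integrals over the whole ball. -/
theorem exists_weightedSq_le (n m : ℕ) (hn : 1 ≤ n) (hm : 1 ≤ m) :
    ∃ C : ℝ, 1 < C ∧ ∀ p : MvPolynomial (Fin n) ℂ, p.totalDegree ≤ m →
      ∀ (f : MvPolynomial (Fin n) ℂ) (k : ℕ),
        (∀ l : ℕ, l ≤ k →
          weightedSq n (2 * k) (fun z => evalAt (radial^[l] p) z * evalAt f z)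
            ≤ ENNReal.ofReal (C ^ (k + 1))
              * weightedSq n (2 * k - 2 * l) (fun z => evalAt p z * evalAt f z)) ∧
        (∀ i j : Fin n,
          weightedSq n (2 * k + 1) (fun z => tangential j i p z * evalAt f z)
            ≤ ENNReal.ofReal (C ^ (k + 1))
              * weightedSq n (2 * k) (fun z => evalAt p z * evalAt f z)) ∧
        (∀ j : Fin n,
          weightedSq n (2 * k + 2) (fun z => evalAt (MvPolynomial.pderiv j p) z * evalAt f z)
            ≤ ENNReal.ofReal (C ^ (k + 1))
              * weightedSq n (2 * k) (fun z => evalAt p z * evalAt f z)) := by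
  obtain ⟨B, hB, hrad⟩ := exists_weightedSq_radial_iterate_le n m hn hm
  have hn2 : (1 : ℝ) ≤ n ^ 2 := one_le_pow₀ (by exact_mod_cast hn)
  have hm2 : (1 : ℝ) ≤ m ^ 2 := one_le_pow₀ (by exact_mod_cast hm)
  set A : ℝ := 2 ^ 24 * n ^ 2 * m ^ 2 with hA
  have hA1 : 2 ^ 24 * (m : ℝ) ^ 2 ≤ A := by
    rw [hA]
    nlinarith
  have hA2 : (2 : ℝ) ≤ A := by linarith
  have hAm : 16 * A ≤ (16 * A) ^ m := le_self_pow₀ (by linarith) (by omega)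
  set C : ℝ := B * m ^ 2 * (16 * A) ^ m with hC
  have hBm : 1 ≤ B * (m : ℝ) ^ 2 := one_le_mul_of_one_le_of_one_le hB hm2
  have hAC : 16 * A ≤ C := hAm.trans (le_mul_of_one_le_left (by linarith) hBm)
  have hC1 : 1 < C := by linarith
  have hfirst : ∀ k : ℕ, 2 ^ 24 * (m : ℝ) ^ 2 * 4 ^ (2 * k) ≤ C ^ (k + 1) := by
    intro k
    rw [pow_mul, pow_succ' C k]
    have h1 : ((4 : ℝ) ^ 2) ^ k ≤ C ^ k := by
      gcongr
      linarith
    exact mul_le_mul (by linarith) h1 (by positivity) (by positivity)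
  refine ⟨C, hC1, fun p hp f k => ⟨fun l hl => (hrad p hp f k l hl).trans ?_,
    fun i j => (weightedSq_tangential_mul_le hp f j i (2 * k)).trans ?_,
    fun j => (weightedSq_pderiv_mul_le hp f j (2 * k)).trans ?_⟩⟩
  · gcongr ?_ * _
    refine ENNReal.ofReal_le_ofReal ?_
    calc B * (m ^ 2) ^ k * (A * 16 ^ k) ^ m
        ≤ B ^ (k + 1) * (m ^ 2) ^ (k + 1) * ((16 * A) ^ (k + 1)) ^ m := by
          have hpow : A * 16 ^ k ≤ (16 * A) ^ (k + 1) := by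
            rw [mul_pow, mul_comm]
            exact mul_le_mul (pow_le_pow_right₀ (by norm_num) (by omega))
              (le_self_pow₀ (by linarith) (by omega)) (by positivity) (by positivity)
          gcongr ?_ * ?_ * ?_ ^ m
          · exact le_self_pow₀ hB (by omega)
          · exact pow_le_pow_right₀ hm2 (by omega)
      _ = C ^ (k + 1) := by rw [hC, pow_right_comm (16 * A), ← mul_pow, ← mul_pow]
  · gcongr ?_ * _
    exact ENNReal.ofReal_le_ofReal (hfirst k)
  · gcongr ?_ * _
    exact ENNReal.ofReal_le_ofReal (hfirst k)

/-! ### Real-valued integrals -/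

lemma integrableOn_weight {n : ℕ} (t : ℕ) {g : EuclideanSpace ℂ (Fin n) → ℂ}
    (hg : Continuous g) :
    IntegrableOn (fun z => ‖g z‖ ^ 2 * (1 - ‖z‖ ^ 2) ^ t) (unitBall n) :=
  integrableOn_ball_of_continuous (by fun_prop) 0 1

lemma weight_nonneg_ae {n : ℕ} (t : ℕ) (g : EuclideanSpace ℂ (Fin n) → ℂ) :
    0 ≤ᵐ[volume.restrict (unitBall n)] fun z => ‖g z‖ ^ 2 * (1 - ‖z‖ ^ 2) ^ t := by
  filter_upwards [ae_restrict_mem (measurableSet_unitBall n)] with z hz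
  have := one_sub_norm_sq_pos hz
  change 0 ≤ ‖g z‖ ^ 2 * (1 - ‖z‖ ^ 2) ^ t
  positivity

lemma ofReal_setIntegral_weight {n : ℕ} (t : ℕ) {g : EuclideanSpace ℂ (Fin n) → ℂ}
    (hg : Continuous g) :
    ENNReal.ofReal (∫ z in unitBall n, ‖g z‖ ^ 2 * (1 - ‖z‖ ^ 2) ^ t) = weightedSq n t g :=
  ofReal_integral_eq_lintegral_ofReal (integrableOn_weight t hg) (weight_nonneg_ae t g)

lemma setIntegral_weight_nonneg {n : ℕ} (t : ℕ) (g : EuclideanSpace ℂ (Fin n) → ℂ) :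
    0 ≤ ∫ z in unitBall n, ‖g z‖ ^ 2 * (1 - ‖z‖ ^ 2) ^ t :=
  integral_nonneg_of_ae (weight_nonneg_ae t g)

lemma setIntegral_weight_le_of_weightedSq_le {n s t : ℕ} {C : ℝ} (hC : 0 ≤ C)
    {g h : EuclideanSpace ℂ (Fin n) → ℂ} (hg : Continuous g) (hh : Continuous h)
    (hle : weightedSq n s g ≤ ENNReal.ofReal C * weightedSq n t h) :
    ∫ z in unitBall n, ‖g z‖ ^ 2 * (1 - ‖z‖ ^ 2) ^ s
      ≤ C * ∫ z in unitBall n, ‖h z‖ ^ 2 * (1 - ‖z‖ ^ 2) ^ t := by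
  rw [← ofReal_setIntegral_weight s hg, ← ofReal_setIntegral_weight t hh,
    ← ENNReal.ofReal_mul hC] at hle
  exact (ENNReal.ofReal_le_ofReal_iff (mul_nonneg hC (setIntegral_weight_nonneg t h))).mp hle

lemma setIntegral_shell_le {n : ℕ} (r : ℝ) (t : ℕ) {g : EuclideanSpace ℂ (Fin n) → ℂ}
    (hg : Continuous g) :
    ∫ z in shell n r, ‖g z‖ ^ 2 * (1 - ‖z‖ ^ 2) ^ t
      ≤ ∫ z in unitBall n, ‖g z‖ ^ 2 * (1 - ‖z‖ ^ 2) ^ t :=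
  setIntegral_mono_set (integrableOn_weight t hg) (weight_nonneg_ae t g)
    (Set.sep_subset _ _).eventuallyLE

lemma normSq_eq (n t : ℕ) (g : EuclideanSpace ℂ (Fin n) → ℂ) :
    normSq n t g = ((volume (unitBall n))⁻¹).toReal
      * (c n t * ∫ z in unitBall n, ‖g z‖ ^ 2 * (1 - ‖z‖ ^ 2) ^ t) := by
  rw [normSq, normalizedVolume, integral_smul_measure, smul_eq_mul,
    ← integral_const_mul (c n t)]
  congr 1
  exact integral_congr_ae (.of_forall fun z => by ring)

lemma c_pos (n t : ℕ) : 0 < c n t := by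
  unfold c
  positivity

lemma normSq_le_of_setIntegral_weight_le {n s t : ℕ} {C : ℝ}
    {g h : EuclideanSpace ℂ (Fin n) → ℂ}
    (hle : ∫ z in unitBall n, ‖g z‖ ^ 2 * (1 - ‖z‖ ^ 2) ^ s
      ≤ C * ∫ z in unitBall n, ‖h z‖ ^ 2 * (1 - ‖z‖ ^ 2) ^ t) :
    normSq n s g ≤ c n s * C / c n t * normSq n t h := by
  have hs := c_pos n s
  have ht := c_pos n t
  rw [normSq_eq, normSq_eq]
  calc _ ≤ ((volume (unitBall n))⁻¹).toReal
        * (c n s * (C * ∫ z in unitBall n, ‖h z‖ ^ 2 * (1 - ‖z‖ ^ 2) ^ t)) := by gcongr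
    _ = _ := by field_simp

lemma continuous_tangential {n : ℕ} (j i : Fin n) (p : MvPolynomial (Fin n) ℂ) :
    Continuous (tangential j i p) := by
  have h1 := continuous_evalAt (MvPolynomial.pderiv j p)
  have h2 := continuous_evalAt (MvPolynomial.pderiv i p)
  have h3 : ∀ k : Fin n, Continuous fun z : EuclideanSpace ℂ (Fin n) => conj (z k) := fun k =>
    Complex.continuous_conj.comp (by fun_prop)
  exact ((h3 i).mul h1).sub ((h3 j).mul h2)

end PolyBergman

theorem proposition2p2 (n m : ℕ) (hn : 1 ≤ n) (hm : 1 ≤ m) :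
    (∃ C : ℝ, 1 < C ∧
      ∀ p : MvPolynomial (Fin n) ℂ, p.totalDegree = m →
      ∀ (f : MvPolynomial (Fin n) ℂ) (k : ℕ),
        (∀ l : ℕ, l ≤ k →
          PolyBergman.normSq n (2 * k)
              (fun z => PolyBergman.evalAt (PolyBergman.radial^[l] p) z * PolyBergman.evalAt f z)
            ≤ PolyBergman.c n (2 * k) * C ^ (k + 1) / PolyBergman.c n (2 * k - 2 * l)
              * PolyBergman.normSq n (2 * k - 2 * l)
                  (fun z => PolyBergman.evalAt p z * PolyBergman.evalAt f z)) ∧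
        (∀ i j : Fin n, i ≠ j →
          PolyBergman.normSq n (2 * k + 1)
              (fun z => PolyBergman.tangential j i p z * PolyBergman.evalAt f z)
            ≤ PolyBergman.c n (2 * k + 1) * C ^ (k + 1) / PolyBergman.c n (2 * k)
              * PolyBergman.normSq n (2 * k)
                  (fun z => PolyBergman.evalAt p z * PolyBergman.evalAt f z)) ∧
        (∀ j : Fin n,
          PolyBergman.normSq n (2 * k + 2)
              (fun z => PolyBergman.evalAt (MvPolynomial.pderiv j p) z * PolyBergman.evalAt f z)
            ≤ PolyBergman.c n (2 * k + 2) * C ^ (k + 1) / PolyBergman.c n (2 * k)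
              * PolyBergman.normSq n (2 * k)
                  (fun z => PolyBergman.evalAt p z * PolyBergman.evalAt f z))) ∧
    (∃ C : ℝ, 1 < C ∧
      ∀ p : MvPolynomial (Fin n) ℂ, p.totalDegree = m →
      ∀ (f : MvPolynomial (Fin n) ℂ) (k : ℕ),
        (∀ l : ℕ, l ≤ k →
          ∫ z in PolyBergman.shell n (1 / 2),
              ‖PolyBergman.evalAt (PolyBergman.radial^[l] p) z * PolyBergman.evalAt f z‖ ^ 2
                * (1 - ‖z‖ ^ 2) ^ (2 * k)
            ≤ C ^ (k + 1) * ∫ z in PolyBergman.unitBall n,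
              ‖PolyBergman.evalAt p z * PolyBergman.evalAt f z‖ ^ 2
                * (1 - ‖z‖ ^ 2) ^ (2 * k - 2 * l)) ∧
        (∀ i j : Fin n, i ≠ j →
          ∫ z in PolyBergman.shell n (1 / 2),
              ‖PolyBergman.tangential j i p z * PolyBergman.evalAt f z‖ ^ 2
                * (1 - ‖z‖ ^ 2) ^ (2 * k + 1)
            ≤ C ^ (k + 1) * ∫ z in PolyBergman.unitBall n,
              ‖PolyBergman.evalAt p z * PolyBergman.evalAt f z‖ ^ 2
                * (1 - ‖z‖ ^ 2) ^ (2 * k)) ∧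
        (∀ j : Fin n,
          ∫ z in PolyBergman.shell n (1 / 2),
              ‖PolyBergman.evalAt (MvPolynomial.pderiv j p) z * PolyBergman.evalAt f z‖ ^ 2
                * (1 - ‖z‖ ^ 2) ^ (2 * k + 2)
            ≤ C ^ (k + 1) * ∫ z in PolyBergman.unitBall n,
              ‖PolyBergman.evalAt p z * PolyBergman.evalAt f z‖ ^ 2
                * (1 - ‖z‖ ^ 2) ^ (2 * k))) := by
  obtain ⟨C, hC, hall⟩ := PolyBergman.exists_weightedSq_le n m hn hm
  have hC0 : ∀ k : ℕ, 0 ≤ C ^ (k + 1) := fun k => by positivity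
  have hcont : ∀ p f : MvPolynomial (Fin n) ℂ,
      Continuous fun z => PolyBergman.evalAt p z * PolyBergman.evalAt f z := fun p f =>
    (PolyBergman.continuous_evalAt p).mul (PolyBergman.continuous_evalAt f)
  have hcontL : ∀ (j i : Fin n) (p f : MvPolynomial (Fin n) ℂ),
      Continuous fun z => PolyBergman.tangential j i p z * PolyBergman.evalAt f z :=
    fun j i p f =>
      (PolyBergman.continuous_tangential j i p).mul (PolyBergman.continuous_evalAt f)
  refine ⟨⟨C, hC, fun p hp f k => ?_⟩, ⟨C, hC, fun p hp f k => ?_⟩⟩ <;>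
    obtain ⟨hR, hL, hD⟩ := hall p hp.le f k
  · exact ⟨fun l hl => PolyBergman.normSq_le_of_setIntegral_weight_le
        (PolyBergman.setIntegral_weight_le_of_weightedSq_le (hC0 k) (hcont _ f) (hcont p f)
          (hR l hl)),
      fun i j _ => PolyBergman.normSq_le_of_setIntegral_weight_le
        (PolyBergman.setIntegral_weight_le_of_weightedSq_le (hC0 k) (hcontL j i p f) (hcont p f)
          (hL i j)),
      fun j => PolyBergman.normSq_le_of_setIntegral_weight_le
        (PolyBergman.setIntegral_weight_le_of_weightedSq_le (hC0 k) (hcont _ f) (hcont p f)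
          (hD j))⟩
  · exact ⟨fun l hl => (PolyBergman.setIntegral_shell_le _ _ (hcont _ f)).trans
        (PolyBergman.setIntegral_weight_le_of_weightedSq_le (hC0 k) (hcont _ f) (hcont p f)
          (hR l hl)),
      fun i j _ => (PolyBergman.setIntegral_shell_le _ _ (hcontL j i p f)).trans
        (PolyBergman.setIntegral_weight_le_of_weightedSq_le (hC0 k) (hcontL j i p f) (hcont p f)
          (hL i j)),
      fun j => (PolyBergman.setIntegral_shell_le _ _ (hcont _ f)).trans
        (PolyBergman.setIntegral_weight_le_of_weightedSq_le (hC0 k) (hcont _ f) (hcont p f)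
          (hD j))⟩
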